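/- Let $\Omega$ be a finite probability space with probability measure $\mu$ such that every point of $\Omega$ is measurable and has positive mass. Let $n\ge 0$ and let $P=\mu^n$ be the product measure on $\Omega^n$. Define $\psi(t)=t^2/4$ for $t\le 2$ and $\psi(t)=t-1$ for $t\ge 2$. For a probability measure $\nu$ on $\Omega^n$, a point $x\in\Omega^n$ and $1\le i\le n$, let $d_i=d_i(\nu,x)$ be the Radon–Nikodym derivative with respect to $\mu$ of the image, under the map $y\mapsto y_i$, of the restriction of $\nu$ to $\{y\in\Omega^n : y_i\neq x_i\}$. Put $$m(\nu,x)=\sum_{i=1}^n\int_\Omega\psi(d_i)\,d\mu,\qquad m(A,x)=\inf\{m(\nu,x) : \nu \text{ a probability measure on } \Omega^n,\ \nu(A)=1\}$$ for $A\subseteq\Omega^n$. Then for every real $L\ge 1.12$, every $n$ and every $A\subseteq\Omega^n$, $$\int_{\Omega^n}\exp\Bigl(\frac1L\,m(A,x)\Bigr)\,dP(x)\le\frac{1}{P(A)},$$ where for $A=\emptyset$ the conventions $\inf\emptyset=+\infty$, $\exp(+\infty)=+\infty$ and $1/0=+\infty$ are used. -/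

import Mathlib

open MeasureTheory

noncomputable section

namespace TalagrandDist

/-- The function `ψ`: `x² / 4` for `x ≤ 2` and `x - 1` for `x ≥ 2` (both equal `1` at `2`). -/
def psi (x : ℝ) : ℝ := if x ≤ 2 then x ^ 2 / 4 else x - 1

variable {Ω : Type*} [MeasurableSpace Ω] {n : ℕ}

/-- The image, under `y ↦ y i`, of the restriction of `ν` to `{y | y i ≠ x i}`. -/
def offMarginal (ν : Measure (Fin n → Ω)) (x : Fin n → Ω) (i : Fin n) : Measure Ω :=
  (ν.restrict {y | y i ≠ x i}).map (fun y => y i)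

/-- The density `d_i` of that image with respect to `μ`. -/
def density (μ : Measure Ω) (ν : Measure (Fin n → Ω)) (x : Fin n → Ω) (i : Fin n) (ω : Ω) : ℝ :=
  ((offMarginal ν x i).rnDeriv μ ω).toReal

/-- `m(ν, x) = ∑ i, ∫ ψ(d_i) dμ`. -/
def mMeas (μ : Measure Ω) (ν : Measure (Fin n → Ω)) (x : Fin n → Ω) : ℝ :=
  ∑ i, ∫ ω, psi (density μ ν x i ω) ∂μ

/-- `m(A, x)`, the infimum of `m(ν, x)` over all probability measures `ν` with `ν(A) = 1`
(an infimum of extended reals, so that it is `+∞` when there is no such `ν`). -/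
def mSet (μ : Measure Ω) (A : Set (Fin n → Ω)) (x : Fin n → Ω) : EReal :=
  ⨅ (ν : ProbabilityMeasure (Fin n → Ω)) (_ : (ν : Measure (Fin n → Ω)) A = 1),
    ((mMeas μ (ν : Measure (Fin n → Ω)) x : ℝ) : EReal)

end TalagrandDist

end

/-!
The argument is an induction on `n` by sections. All integrals over `Ω` are finite sums with weights
`p ω = μ {ω}`, and instead of the infimum `m(A, x)` the induction controls an explicit choice
`x ↦ q x` of probability weights on `A` (`exists_kernel`). As `m ≥ 0`, only `L = 1.12` matters.

For the step, write a point of `Ω ^ (n + 1)` as `(ω, x)`, let `A_k` be the section of `A` at first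
coordinate `k`, and let `g k = P(A_k)`. If `Q k x` are the weights already found for `A_k`, use at
`(ω, x)` the mixture `∑ k, θ ω k • (δ_k ⊗ Q k x)`. As `ψ` is convex, its cost is at most the cost of
`θ ω` in the first coordinate plus `∑ k, θ ω k * cost (Q k x)` (`cost_mixture_le`). Convexity of
`exp` (Hölder's inequality in disguise, `sum_exp_mixture_le_one`) then integrates out `x`, and it
remains to find, for each `g : Ω → [0, ∞)`, weights `θ` for which
`∑ ω, p ω * exp (cost (θ ω) / L - ∑ k, θ ω k * log (g k))` is at most `(∑ k, p k * g k)⁻¹`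
(`exists_weights`).

Put `h = - log g` and `b = 1 / 1.12 = 25 / 28`. Minimising over `θ ω` by Lagrange duality suggests the
density `2 L (u - h)₊` with `u = min (h ω) c`, the remaining mass being placed at `ω`, or at a minimum
of `h` when `h ω` exceeds the truncation level `c ≤ min h + b`. With `H = min h c` this gives the value
`H ω - L E (H ω - H)₊²`, so the whole statement is reduced to
`E exp (H - L E' (H - H')₊²) * E exp (-H) ≤ 1` for a random variable `H` of oscillation at most
`1 / L`, where `H'` is an independent copy (`sum_exp_mul_sum_exp_neg_le_one`).

In the last inequality, `H` is replaced by the centred variable `b X = E H - H`. With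
`f = b E' (X' - X)₊²` it suffices, by the arithmetic-geometric mean inequality, that
`E (exp (b X) + exp (-b X) - 2) ≤ E exp (-b X) (1 - exp (-f))`. The left side is at most
`b² C E X²`, where `C` is slightly larger than `1`. On the right, a pointwise estimate
(`mul_le_exp_neg_mul_one_sub_exp_neg`) bounds the integrand below by `b f (C - γ X)` with `γ ≥ 0`.
Since `f` is a decreasing function of `X` and `E X = 0`, `E f X ≤ 0`; and `E f = b E X²` by symmetry.
-/

namespace TalagrandDist

/-! ### Pointwise estimates -/

theorem one_sub_add_sq_le_exp_neg {y : ℝ} (h₁ : -1 ≤ y) (h₂ : y ≤ 25 / 28) :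
    1 - y + 3 / 8 * y ^ 2 ≤ Real.exp (-y) := by
  have hy : |(-y)| ≤ 1 := by rw [abs_neg]; exact abs_le.2 ⟨h₁, by linarith⟩
  have h := (abs_le.1 (Real.exp_bound hy (n := 6) (by norm_num))).1
  have h6 : |(-y)| ^ 6 = y ^ 6 := by
    rw [abs_neg]; exact (by decide : Even 6).pow_abs y
  rw [h6] at h
  norm_num [Finset.sum_range_succ, Nat.factorial] at h
  have key : 0 ≤ y ^ 2 * (1 / 8 - y / 6 + y ^ 2 / 24 - y ^ 3 / 120 - y ^ 4 * (7 / 4320)) := by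
    apply mul_nonneg (sq_nonneg y)
    nlinarith [mul_nonneg (sub_nonneg.2 h₂) (by linarith : 0 ≤ y + 1),
      mul_nonneg (mul_nonneg (sub_nonneg.2 h₂) (by linarith : 0 ≤ y + 1)) (sq_nonneg y),
      mul_nonneg (sub_nonneg.2 h₂) (sq_nonneg y), mul_nonneg (sub_nonneg.2 h₂) (sq_nonneg (y - 1 / 2))]
  nlinarith

/-- The constant `137 / 2000` slightly exceeds `(25 / 28) ^ 2 / 12`, the one given by the Taylor
coefficient of order four; the excess absorbs the higher orders for `|z| ≤ 25 / 28`. -/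
theorem exp_add_exp_neg_le {z : ℝ} (hz : |z| ≤ 25 / 28) :
    Real.exp z + Real.exp (-z) ≤ 2 + z ^ 2 * (1 + 137 / 2000 * (28 / 25 * z) ^ 2) := by
  have h1 : |z| ≤ 1 := by linarith
  have h2 : |(-z)| ≤ 1 := by rwa [abs_neg]
  have e1 := (abs_le.1 (Real.exp_bound h1 (n := 8) (by norm_num))).2
  have e2 := (abs_le.1 (Real.exp_bound h2 (n := 8) (by norm_num))).2
  have h6 : |z| ^ 8 = z ^ 8 := (by decide : Even 8).pow_abs z
  rw [abs_neg, h6] at e2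
  rw [h6] at e1
  norm_num [Finset.sum_range_succ, Nat.factorial] at e1 e2
  have hz2 : z ^ 2 ≤ (25 / 28) ^ 2 := sq_le_sq' (abs_le.1 hz).1 (abs_le.1 hz).2
  set s := z ^ 2 with hs
  have hs0 : 0 ≤ s := sq_nonneg z
  have key : 0 ≤ s ^ 2 * (137 / 2000 * (28 / 25) ^ 2 - 1 / 12 - s / 360 - s ^ 2 / 16000) := by
    apply mul_nonneg (sq_nonneg s)
    nlinarith
  have e4 : z ^ 4 = s ^ 2 := by rw [hs]; ring
  have e6 : z ^ 6 = s ^ 3 := by rw [hs]; ring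
  have e8 : z ^ 8 = s ^ 4 := by rw [hs]; ring
  nlinarith [pow_nonneg hs0 4]

/-- The polynomial form of the pointwise estimate, for `a ≤ 1 / 2`. In the Bernstein basis of degree
`(4, 4)` on `[0, 1 / 2] × [0, 1]` the right-hand side has positive coefficients. The slope
`(43 - 14 * a) / 50` is chosen so that this holds both here and on `[1 / 2, 1] × [0, 1]`. -/
theorem polynomial_bound_of_le_half {a r : ℝ} (ha : 0 ≤ a) (ha' : a ≤ 1 / 2) (hr : 0 ≤ r)
    (hr' : r ≤ 1) :
    0 ≤ 28 / 25 - ((1 - a - r) + a * r ^ 2 / 2)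
      + 3 / 8 * (25 / 28) * ((1 - a - r) + a * r ^ 2 / 2) ^ 2
      - (1 + 137 / 2000 * (1 - a) ^ 2) + ((43 - 14 * a) / 50) * (1 - a - r) := by
  have b (i j k l : ℕ) : 0 ≤ a ^ i * (1 / 2 - a) ^ j * (r ^ k * (1 - r) ^ l) := by
    have := sub_nonneg.2 ha'
    have := sub_nonneg.2 hr'
    positivity
  linarith [b 0 4 0 4, b 0 4 1 3, b 0 4 2 2, b 0 4 3 1, b 0 4 4 0,
    b 1 3 0 4, b 1 3 1 3, b 1 3 2 2, b 1 3 3 1, b 1 3 4 0,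
    b 2 2 0 4, b 2 2 1 3, b 2 2 2 2, b 2 2 3 1, b 2 2 4 0,
    b 3 1 0 4, b 3 1 1 3, b 3 1 2 2, b 3 1 3 1, b 3 1 4 0,
    b 4 0 0 4, b 4 0 1 3, b 4 0 2 2, b 4 0 3 1, b 4 0 4 0]

/-- The companion of `polynomial_bound_of_le_half` for `1 / 2 ≤ a`, again by positivity of the
Bernstein coefficients. -/
theorem polynomial_bound_of_half_le {a r : ℝ} (ha : 1 / 2 ≤ a) (ha' : a ≤ 1) (hr : 0 ≤ r)
    (hr' : r ≤ 1) :
    0 ≤ 28 / 25 - ((1 - a - r) + a * r ^ 2 / 2)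
      + 3 / 8 * (25 / 28) * ((1 - a - r) + a * r ^ 2 / 2) ^ 2
      - (1 + 137 / 2000 * a ^ 2) + ((43 - 14 * a) / 50) * (1 - a - r) := by
  have b (i j k l : ℕ) : 0 ≤ (a - 1 / 2) ^ i * (1 - a) ^ j * (r ^ k * (1 - r) ^ l) := by
    have := sub_nonneg.2 ha
    have := sub_nonneg.2 ha'
    have := sub_nonneg.2 hr'
    positivity
  linarith [b 0 4 0 4, b 0 4 1 3, b 0 4 2 2, b 0 4 3 1, b 0 4 4 0,
    b 1 3 0 4, b 1 3 1 3, b 1 3 2 2, b 1 3 3 1, b 1 3 4 0,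
    b 2 2 0 4, b 2 2 1 3, b 2 2 2 2, b 2 2 3 1, b 2 2 4 0,
    b 3 1 0 4, b 3 1 1 3, b 3 1 2 2, b 3 1 3 1, b 3 1 4 0,
    b 4 0 0 4, b 4 0 1 3, b 4 0 2 2, b 4 0 3 1, b 4 0 4 0]

/-- The pointwise estimate behind the constant `1.12`. The range of `x` is an interval `[-a, 1 - a]`
of length one, and the bound assumed on `f` is the one that holds for
`f = 25 / 28 * E (X - x)₊²` when `X` is a centred variable with values in that interval. The factor of
`f` on the left is affine in `x`, with nonpositive slope. -/
theorem mul_le_exp_neg_mul_one_sub_exp_neg {a x f : ℝ} (ha : 0 ≤ a) (ha' : a ≤ 1) (hx : -a ≤ x)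
    (hx' : x ≤ 1 - a) (hf : 0 ≤ f) (hf' : f ≤ 25 / 28 * (a * (1 - a - x) ^ 2)) :
    f * (25 / 28 * (1 + 137 / 2000 * max a (1 - a) ^ 2 - ((43 - 14 * a) / 50) * x))
      ≤ Real.exp (-(25 / 28 * x)) * (1 - Real.exp (-f)) := by
  -- `r` is the distance from `x` to the right end of the interval
  obtain ⟨r, hr⟩ : ∃ r, r = 1 - a - x := ⟨_, rfl⟩
  obtain rfl : x = 1 - a - r := by linarith
  have hr0 : 0 ≤ r := by linarith
  have hr1 : r ≤ 1 := by linarith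
  set Y := (1 - a - r) + a * r ^ 2 / 2 with hY
  have har : 0 ≤ a * r ^ 2 := by positivity
  have hr2 : r ^ 2 ≤ r := by nlinarith
  have hY1 : -1 ≤ Y := by linarith
  have hY2 : Y ≤ 1 := by nlinarith
  have hexp := one_sub_add_sq_le_exp_neg (y := 25 / 28 * Y) (by linarith) (by linarith)
  have hpoly : 25 / 28 * (1 + 137 / 2000 * max a (1 - a) ^ 2 - ((43 - 14 * a) / 50) * (1 - a - r))
      ≤ Real.exp (-(25 / 28 * Y)) := by
    rcases le_total a (1 / 2) with h | h
    · rw [max_eq_right (by linarith)]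
      have h' := polynomial_bound_of_le_half ha h hr0 hr1
      rw [← hY] at h'
      linarith
    · rw [max_eq_left (by linarith)]
      have h' := polynomial_bound_of_half_le h ha' hr0 hr1
      rw [← hY] at h'
      linarith
  -- `1 - exp (-f) = 2 * exp (-f / 2) * sinh (f / 2)`
  have hsinh : f * Real.exp (-(f / 2)) ≤ 1 - Real.exp (-f) := by
    have h1 := Real.self_le_sinh_iff.2 (by linarith : 0 ≤ f / 2)
    rw [Real.sinh_eq] at h1
    have h2 : Real.exp (f / 2) * Real.exp (-(f / 2)) = 1 := by
      rw [← Real.exp_add]; simp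
    have h3 : Real.exp (-f) = Real.exp (-(f / 2)) * Real.exp (-(f / 2)) := by
      rw [← Real.exp_add]; congr 1; ring
    rw [h3]
    nlinarith [Real.exp_pos (-(f / 2))]
  calc _ ≤ f * Real.exp (-(25 / 28 * Y)) := mul_le_mul_of_nonneg_left hpoly hf
    _ ≤ f * Real.exp (-(25 / 28 * (1 - a - r)) - f / 2) := by
        gcongr
        have : (1 - a - (1 - a - r)) = r := by ring
        rw [this] at hf'
        rw [hY]; linarith
    _ = Real.exp (-(25 / 28 * (1 - a - r))) * (f * Real.exp (-(f / 2))) := by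
        rw [sub_eq_add_neg, Real.exp_add]; ring
    _ ≤ _ := mul_le_mul_of_nonneg_left hsinh (Real.exp_pos _).le

/-! ### A Laplace transform inequality for variables of small oscillation -/

open Finset in
/-- The inequality `E exp (-b X - b E' (X' - X)₊²) * E exp (b X) ≤ 1` with `b = 25 / 28`, for a centred
`X` whose values lie in an interval of length one and an independent copy `X'` of `X`. -/
theorem sum_exp_mul_sum_exp_le_one_of_centered {ι : Type*} [Fintype ι] (p X : ι → ℝ)
    (hp : ∀ i, 0 ≤ p i) (hsum : ∑ i, p i = 1) (hmean : ∑ i, p i * X i = 0) (a : ℝ)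
    (hX : ∀ i, -a ≤ X i) (hX' : ∀ i, X i ≤ 1 - a) :
    (∑ i, p i * Real.exp (-(25 / 28 * X i) - 25 / 28 * ∑ k, p k * max (X k - X i) 0 ^ 2)) *
      ∑ i, p i * Real.exp (25 / 28 * X i) ≤ 1 := by
  have ha : 0 ≤ a := by
    have : ∑ i, p i * (-a) ≤ ∑ i, p i * X i :=
      sum_le_sum fun i _ => mul_le_mul_of_nonneg_left (hX i) (hp i)
    rw [← sum_mul, hsum, hmean] at this; linarith
  have ha' : a ≤ 1 := by
    have : ∑ i, p i * X i ≤ ∑ i, p i * (1 - a) :=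
      sum_le_sum fun i _ => mul_le_mul_of_nonneg_left (hX' i) (hp i)
    rw [← sum_mul, hsum, hmean] at this; linarith
  set f : ι → ℝ := fun i => 25 / 28 * ∑ k, p k * max (X k - X i) 0 ^ 2 with hf
  set C : ℝ := 1 + 137 / 2000 * max a (1 - a) ^ 2 with hC
  set γ : ℝ := (43 - 14 * a) / 50 with hγ
  have hγ0 : 0 ≤ γ := by linarith
  have hf0 : ∀ i, 0 ≤ f i := fun i => by
    refine mul_nonneg (by norm_num) (sum_nonneg fun k _ => mul_nonneg (hp k) (sq_nonneg _))
  have hanti : ∀ i j, X i ≤ X j → f j ≤ f i := fun i j hij => by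
    refine mul_le_mul_of_nonneg_left (sum_le_sum fun k _ => ?_) (by norm_num)
    refine mul_le_mul_of_nonneg_left ?_ (hp k)
    exact pow_le_pow_left₀ (le_max_right _ _) (max_le_max (by linarith) le_rfl) 2
  have hfle : ∀ i, f i ≤ 25 / 28 * (a * (1 - a - X i) ^ 2) := fun i => by
    refine mul_le_mul_of_nonneg_left ?_ (by norm_num)
    have h1 : ∀ k, p k * max (X k - X i) 0 ^ 2 ≤ p k * ((1 - a - X i) ^ 2 * (X k + a)) := by
      intro k
      refine mul_le_mul_of_nonneg_left ?_ (hp k)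
      have i1 := hX i
      have i2 := hX' i
      have k1 := hX k
      have k2 := hX' k
      -- the chord of `t ↦ (t - X i)₊` over `[-a, 1 - a]` lies above it, since this interval has
      -- length one
      have hc : max (X k - X i) 0 ≤ (1 - a - X i) * (X k + a) := by
        apply max_le
        · nlinarith [mul_nonneg (sub_nonneg.2 k2) (by linarith : 0 ≤ X i + a)]
        · exact mul_nonneg (by linarith) (by linarith)
      calc max (X k - X i) 0 ^ 2 ≤ ((1 - a - X i) * (X k + a)) ^ 2 :=
            pow_le_pow_left₀ (le_max_right _ _) hc 2
        _ = ((1 - a - X i) ^ 2 * (X k + a)) * (X k + a) := by ring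
        _ ≤ ((1 - a - X i) ^ 2 * (X k + a)) * 1 := by
            refine mul_le_mul_of_nonneg_left (by linarith) ?_
            exact mul_nonneg (sq_nonneg _) (by linarith)
        _ = _ := mul_one _
    calc _ ≤ ∑ k, p k * ((1 - a - X i) ^ 2 * (X k + a)) := sum_le_sum fun k _ => h1 k
      _ = (1 - a - X i) ^ 2 * (∑ k, p k * X k + a * ∑ k, p k) := by
          rw [mul_sum, ← sum_add_distrib, mul_sum]
          exact sum_congr rfl fun k _ => by ring
      _ = _ := by rw [hmean, hsum]; ring
  -- `f` decreases along `X`, hence is negatively correlated with it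
  have hcov : ∑ i, p i * (f i * X i) ≤ 0 := by
    have hd : 0 ≤ ∑ i, ∑ j, p i * p j * ((f i - f j) * (X j - X i)) := by
      refine sum_nonneg fun i _ => sum_nonneg fun j _ => mul_nonneg (mul_nonneg (hp i) (hp j)) ?_
      rcases le_total (X i) (X j) with h | h
      · exact mul_nonneg (sub_nonneg.2 (hanti i j h)) (sub_nonneg.2 h)
      · exact mul_nonneg_of_nonpos_of_nonpos (sub_nonpos.2 (hanti j i h)) (sub_nonpos.2 h)
    have he : ∑ i, ∑ j, p i * p j * ((f i - f j) * (X j - X i)) =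
        (∑ i, p i * f i) * (∑ j, p j * X j) + (∑ i, p i * X i) * (∑ j, p j * f j)
        - (∑ i, p i * (f i * X i)) * (∑ j, p j) - (∑ i, p i) * (∑ j, p j * (f j * X j)) := by
      simp only [sum_mul_sum, ← sum_add_distrib, ← sum_sub_distrib]
      exact sum_congr rfl fun i _ => sum_congr rfl fun j _ => by ring
    rw [he, hmean, hsum] at hd
    linarith
  -- `(X - X')₊² + (X' - X)₊² = (X - X')²`, and both terms have the same mean
  have hvar : ∑ i, p i * f i = 25 / 28 * ∑ i, p i * X i ^ 2 := by
    have h1 : ∑ i, p i * f i = 25 / 28 * ∑ i, ∑ k, p i * p k * max (X k - X i) 0 ^ 2 := by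
      simp only [hf, mul_sum]
      exact sum_congr rfl fun i _ => sum_congr rfl fun j _ => by ring
    have h2 : ∑ i, ∑ k, p i * p k * max (X k - X i) 0 ^ 2 =
        ∑ i, ∑ k, p i * p k * max (X i - X k) 0 ^ 2 := by
      rw [sum_comm]
      exact sum_congr rfl fun i _ => sum_congr rfl fun j _ => by ring
    have h3 : ∑ i, ∑ k, p i * p k * max (X k - X i) 0 ^ 2 +
        ∑ i, ∑ k, p i * p k * max (X i - X k) 0 ^ 2 =
        (∑ i, p i * X i ^ 2) * (∑ k, p k) + (∑ i, p i) * (∑ k, p k * X k ^ 2)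
          - (∑ i, p i * X i) * (∑ k, p k * X k) - (∑ i, p i * X i) * (∑ k, p k * X k) := by
      simp only [sum_mul_sum, ← sum_add_distrib, ← sum_sub_distrib]
      refine sum_congr rfl fun i _ => sum_congr rfl fun k _ => ?_
      rcases le_total (X i) (X k) with h | h
      · rw [max_eq_left (sub_nonneg.2 h), max_eq_right (sub_nonpos.2 h)]; ring
      · rw [max_eq_right (sub_nonpos.2 h), max_eq_left (sub_nonneg.2 h)]; ring
    rw [hmean, hsum] at h3
    rw [h1]; linarith
  have hpt : ∀ i, Real.exp (-(25 / 28 * X i) - f i) + Real.exp (25 / 28 * X i) ≤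
      2 + (25 / 28 * X i) ^ 2 * C - f i * (25 / 28 * (C - γ * X i)) := by
    intro i
    have h1 := mul_le_exp_neg_mul_one_sub_exp_neg ha ha' (hX i) (hX' i) (hf0 i) (hfle i)
    rw [← hC, ← hγ] at h1
    have habs : |X i| ≤ max a (1 - a) :=
      abs_le.2 ⟨by linarith [hX i, le_max_left a (1 - a)], (hX' i).trans (le_max_right _ _)⟩
    have hM : max a (1 - a) ≤ 1 := max_le ha' (by linarith)
    have h2 := exp_add_exp_neg_le (z := 25 / 28 * X i) (by
      rw [abs_mul, abs_of_pos (by norm_num : (0 : ℝ) < 25 / 28)]; linarith)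
    have h3 : (25 / 28 * X i) ^ 2 * (1 + 137 / 2000 * (28 / 25 * (25 / 28 * X i)) ^ 2) ≤
        (25 / 28 * X i) ^ 2 * C := by
      refine mul_le_mul_of_nonneg_left ?_ (sq_nonneg _)
      have : X i ^ 2 ≤ max a (1 - a) ^ 2 := sq_le_sq.2 (habs.trans (le_abs_self _))
      rw [hC]; linarith
    have h4 : Real.exp (-(25 / 28 * X i) - f i) =
        Real.exp (-(25 / 28 * X i)) * Real.exp (-f i) := by
      rw [sub_eq_add_neg, Real.exp_add]
    rw [h4]
    linarith
  have htot : ∑ i, p i * Real.exp (-(25 / 28 * X i) - f i) +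
      ∑ i, p i * Real.exp (25 / 28 * X i) ≤ 2 := by
    calc _ = ∑ i, p i * (Real.exp (-(25 / 28 * X i) - f i) + Real.exp (25 / 28 * X i)) := by
          rw [← sum_add_distrib]; exact sum_congr rfl fun i _ => by ring
      _ ≤ ∑ i, p i * (2 + (25 / 28 * X i) ^ 2 * C - f i * (25 / 28 * (C - γ * X i))) :=
          sum_le_sum fun i _ => mul_le_mul_of_nonneg_left (hpt i) (hp i)
      _ = 2 * ∑ i, p i + (25 / 28) ^ 2 * C * ∑ i, p i * X i ^ 2 - 25 / 28 * C * ∑ i, p i * f i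
          + 25 / 28 * γ * ∑ i, p i * (f i * X i) := by
          simp only [mul_sum, ← sum_add_distrib, ← sum_sub_distrib]
          exact sum_congr rfl fun i _ => by ring
      _ ≤ 2 := by
          rw [hsum, hvar]
          have := mul_nonneg hγ0 (neg_nonneg.2 hcov)
          linarith
  have hnn : 0 ≤ ∑ i, p i * Real.exp (-(25 / 28 * X i) - f i) :=
    sum_nonneg fun i _ => mul_nonneg (hp i) (Real.exp_pos _).le
  have hnn' : 0 ≤ ∑ i, p i * Real.exp (25 / 28 * X i) :=
    sum_nonneg fun i _ => mul_nonneg (hp i) (Real.exp_pos _).le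
  nlinarith [sq_nonneg (∑ i, p i * Real.exp (-(25 / 28 * X i) - f i) -
    ∑ i, p i * Real.exp (25 / 28 * X i))]

open Finset in
/-- The inequality `E exp (H - L E' (H - H')₊²) * E exp (-H) ≤ 1` with `L = 28 / 25 = 1.12`, for a
variable `H` of oscillation at most `1 / L`. -/
theorem sum_exp_mul_sum_exp_neg_le_one {ι : Type*} [Fintype ι] (p H : ι → ℝ)
    (hp : ∀ i, 0 ≤ p i) (hsum : ∑ i, p i = 1) (h₀ : ℝ)
    (hH : ∀ i, h₀ ≤ H i) (hH' : ∀ i, H i ≤ h₀ + 25 / 28) :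
    (∑ i, p i * Real.exp (H i - 28 / 25 * ∑ k, p k * max (H i - H k) 0 ^ 2)) *
      ∑ i, p i * Real.exp (-H i) ≤ 1 := by
  set m := ∑ i, p i * H i with hm
  have key := sum_exp_mul_sum_exp_le_one_of_centered p (fun i => 28 / 25 * (m - H i)) hp hsum
    (by
      have : ∑ i, p i * (28 / 25 * (m - H i)) =
          28 / 25 * (m * ∑ i, p i - ∑ i, p i * H i) := by
        simp only [mul_sum, ← sum_sub_distrib]
        exact sum_congr rfl fun i _ => by ring
      rw [this, hsum, ← hm]; ring)
    (28 / 25 * (h₀ + 25 / 28 - m)) (fun i => by linarith [hH' i]) (fun i => by linarith [hH i])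
  have e1 : ∀ i, -(25 / 28 * (28 / 25 * (m - H i))) - 25 / 28 * ∑ k, p k *
      max (28 / 25 * (m - H k) - 28 / 25 * (m - H i)) 0 ^ 2 =
      -m + (H i - 28 / 25 * ∑ k, p k * max (H i - H k) 0 ^ 2) := by
    intro i
    have : ∀ k, p k * max (28 / 25 * (m - H k) - 28 / 25 * (m - H i)) 0 ^ 2 =
        (28 / 25) ^ 2 * (p k * max (H i - H k) 0 ^ 2) := by
      intro k
      have : max (28 / 25 * (m - H k) - 28 / 25 * (m - H i)) 0 =
          28 / 25 * max (H i - H k) 0 := by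
        rw [mul_max_of_nonneg _ _ (by norm_num : (0 : ℝ) ≤ 28 / 25)]
        congr 1 <;> ring
      rw [this]; ring
    simp only [this, ← mul_sum]
    ring
  have e2 : ∀ i, 25 / 28 * (28 / 25 * (m - H i)) = m + -H i := fun i => by ring
  simp only [e1] at key
  simp only [e2, Real.exp_add, mul_left_comm (p _), ← mul_sum] at key
  have e3 : Real.exp (-m) * Real.exp m = 1 := by rw [← Real.exp_add]; simp
  calc _ = (Real.exp (-m) * Real.exp m) * _ := by rw [e3, one_mul]
    _ ≤ 1 := le_of_eq_of_le (by ring) key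

/-! ### The penalty function -/

theorem psi_nonneg (x : ℝ) : 0 ≤ psi x := by
  unfold psi; split_ifs <;> [positivity; linarith]

theorem psi_zero : psi 0 = 0 := by norm_num [psi]

/-- Every point of the graph of `psi` has a supporting line below the graph, so `psi` is convex. -/
theorem exists_psi_subgradient (x : ℝ) : ∃ s, ∀ y, psi x + s * (y - x) ≤ psi y := by
  refine ⟨if x ≤ 2 then x / 2 else 1, fun y => ?_⟩
  unfold psi
  split_ifs <;> nlinarith [sq_nonneg (x - y), sq_nonneg (y - 2), sq_nonneg (x - 2)]

theorem psi_add_le {x t : ℝ} (ht : 0 ≤ t) : psi (x + t) ≤ psi x + t := by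
  unfold psi
  split_ifs <;> nlinarith [sq_nonneg (x - 2)]

open Finset in
theorem psi_sum_le {ι : Type*} (s : Finset ι) (θ a : ι → ℝ) (hθ : ∀ i ∈ s, 0 ≤ θ i)
    (hsum : ∑ i ∈ s, θ i = 1) : psi (∑ i ∈ s, θ i * a i) ≤ ∑ i ∈ s, θ i * psi (a i) := by
  set m := ∑ i ∈ s, θ i * a i with hm
  obtain ⟨c, hc⟩ := exists_psi_subgradient m
  calc psi m = psi m * ∑ i ∈ s, θ i + c * (∑ i ∈ s, θ i * a i - m * ∑ i ∈ s, θ i) := by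
        rw [hsum, ← hm]; ring
    _ = ∑ i ∈ s, θ i * (psi m + c * (a i - m)) := by
        simp only [mul_sum, ← sum_add_distrib, ← sum_sub_distrib]
        exact sum_congr rfl fun i _ => by ring
    _ ≤ _ := sum_le_sum fun i hi => mul_le_mul_of_nonneg_left (hc _) (hθ i hi)

/-! ### Optimal weights in one coordinate -/

open Finset in
/-- The truncation level `c`. Either the densities `2 * 1.12 * (c - h)₊` have total mass exactly one, or
`c` is the largest level allowed and their mass is at most one. -/
theorem exists_truncation_level {ι : Type*} [Fintype ι] (p h : ι → ℝ) (h₀ : ℝ)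
    (hh : ∀ i, h₀ ≤ h i) :
    ∃ c, h₀ < c ∧ c ≤ h₀ + 25 / 28 ∧ 56 / 25 * ∑ k, p k * max (c - h k) 0 ≤ 1 ∧
      (56 / 25 * ∑ k, p k * max (c - h k) 0 = 1 ∨ c = h₀ + 25 / 28) := by
  set N : ℝ → ℝ := fun c => 56 / 25 * ∑ k, p k * max (c - h k) 0 with hN
  have hcont : Continuous N := by fun_prop
  have hN0 : N h₀ = 0 := by
    have : ∀ k, max (h₀ - h k) 0 = 0 := fun k => max_eq_right (by linarith [hh k])
    simp [hN, this]
  rcases le_or_gt (N (h₀ + 25 / 28)) 1 with h1 | h1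
  · exact ⟨h₀ + 25 / 28, by linarith, le_rfl, h1, Or.inr rfl⟩
  · obtain ⟨c, ⟨hc1, hc2⟩, hc⟩ := intermediate_value_Icc (by linarith : h₀ ≤ h₀ + 25 / 28)
      hcont.continuousOn (show (1 : ℝ) ∈ Set.Icc (N h₀) (N (h₀ + 25 / 28)) from
        ⟨by rw [hN0]; norm_num, h1.le⟩)
    refine ⟨c, lt_of_le_of_ne hc1 ?_, hc2, hc.le, Or.inl hc⟩
    rintro rfl
    rw [hN0] at hc
    norm_num at hc

open Finset in
/-- The one-dimensional case in the form used by the induction: `θ ω` is the distribution of the first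
coordinate chosen at `ω`, and `g k` stands for the probability of the section at `k`. The bound is
invariant under scaling of `g`, so `g ≤ 1` plays no role. -/
theorem exists_weights {Ω : Type*} [Fintype Ω] [DecidableEq Ω] (p : Ω → ℝ) (hp : ∀ ω, 0 < p ω)
    (hsum : ∑ ω, p ω = 1) (g : Ω → ℝ) (hg : ∀ k, 0 ≤ g k) (k₀ : Ω) (hk₀ : 0 < g k₀)
    (hmax : ∀ k, g k ≤ g k₀) :
    ∃ θ : Ω → Ω → ℝ, (∀ ω k, 0 ≤ θ ω k) ∧ (∀ ω, ∑ k, θ ω k = 1) ∧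
      (∀ ω k, g k = 0 → θ ω k = 0) ∧
      (∑ ω, p ω * Real.exp ((∑ v, if v = ω then 0 else p v * psi (θ ω v / p v)) / 1.12
        - ∑ k, θ ω k * Real.log (g k))) * ∑ k, p k * g k ≤ 1 := by
  -- `h = -log g`, truncated at `h₀ + 1 / 1.12`; where `g` vanishes `-log g` stands for `+∞`, whereas
  -- `Real.log 0 = 0`
  set h₀ := -Real.log (g k₀) with hh₀
  set h : Ω → ℝ := fun k => if 0 < g k then min (-Real.log (g k)) (h₀ + 25 / 28) else h₀ + 25 / 28
    with hh
  have hlb : ∀ k, h₀ ≤ h k := fun k => by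
    simp only [hh]
    split_ifs with hgk
    · exact le_min (neg_le_neg (Real.log_le_log hgk (hmax k))) (by linarith)
    · linarith
  have hexp : ∀ k, g k ≤ Real.exp (-h k) := fun k => by
    simp only [hh]
    split_ifs with hgk
    · calc g k = Real.exp (Real.log (g k)) := (Real.exp_log hgk).symm
        _ ≤ _ := Real.exp_le_exp.2 (by linarith [min_le_left (-Real.log (g k)) (h₀ + 25 / 28)])
    · exact (not_lt.1 hgk).trans (Real.exp_pos _).le
  have hactive : ∀ k, h k < h₀ + 25 / 28 → 0 < g k ∧ -Real.log (g k) = h k := fun k hk => by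
    simp only [hh] at hk ⊢
    split_ifs at hk ⊢ with hgk
    · refine ⟨hgk, ?_⟩
      rcases min_lt_iff.1 hk with h1 | h1
      · exact (min_eq_left h1.le).symm
      · exact absurd h1 (lt_irrefl _)
    · exact absurd hk (lt_irrefl _)
  obtain ⟨c, hc0, hc1, hcN, hcN'⟩ := exists_truncation_level p h h₀ hlb
  set H : Ω → ℝ := fun k => min (h k) c with hH
  have hHlb : ∀ k, h₀ ≤ H k := fun k => le_min (hlb k) hc0.le
  have hHc : ∀ k, H k ≤ c := fun k => min_le_right _ _
  have hHh : ∀ k, H k ≤ h k := fun k => min_le_left _ _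
  have hHactive : ∀ k, H k < c → 0 < g k ∧ -Real.log (g k) = H k := fun k hk => by
    have h1 : h k < c := by
      rcases min_lt_iff.1 hk with h1 | h1
      · exact h1
      · exact absurd h1 (lt_irrefl _)
    have h2 : H k = h k := min_eq_left h1.le
    rw [h2]
    exact hactive k (h1.trans_le hc1)
  have hcH : ∀ k, max (c - H k) 0 = max (c - h k) 0 := fun k => by
    simp only [hH]
    rcases le_total (h k) c with h1 | h1
    · rw [min_eq_left h1]
    · rw [min_eq_right h1, max_eq_right (by linarith), max_eq_right (by linarith)]
  -- the density minimising `psi (w) / 1.12 - w * (H ω - H k)` for each `k`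
  set w : Ω → Ω → ℝ := fun ω k => 56 / 25 * max (H ω - H k) 0 with hw
  have hw0 : ∀ ω k, 0 ≤ w ω k := fun ω k => mul_nonneg (by norm_num) (le_max_right _ _)
  have hw2 : ∀ ω k, w ω k ≤ 2 := fun ω k => by
    have : max (H ω - H k) 0 ≤ 25 / 28 :=
      max_le (by linarith [hHlb k, hHc ω]) (by norm_num)
    simp only [hw]; linarith
  have hwactive : ∀ ω k, w ω k ≠ 0 → 0 < g k ∧ -Real.log (g k) = H k := fun ω k hne => by
    apply hHactive
    by_contra hcon
    apply hne
    have : max (H ω - H k) 0 = 0 := max_eq_right (by linarith [hHc ω, not_lt.1 hcon])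
    simp only [hw, this, mul_zero]
  -- the mass left over by `w`
  set e : Ω → ℝ := fun ω => 1 - ∑ k, p k * w ω k with he
  have he0 : ∀ ω, 0 ≤ e ω := fun ω => by
    have : ∑ k, p k * w ω k ≤ 56 / 25 * ∑ k, p k * max (c - h k) 0 := by
      rw [mul_sum]
      refine sum_le_sum fun k _ => ?_
      have : max (H ω - H k) 0 ≤ max (c - h k) 0 := by
        rw [← hcH]; exact max_le_max (by linarith [hHc ω]) le_rfl
      have := mul_le_mul_of_nonneg_left this (hp k).le
      simp only [hw]; linarith
    simp only [he]; linarith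
  -- mass is left over at a truncated point only if `c` is the largest level, where moving mass to `k₀`
  -- costs exactly what it gains, `psi` having slope one far out
  have hec : ∀ ω, H ω = c → e ω * (h₀ + 25 / 28 - c) = 0 := fun ω hω => by
    rcases hcN' with h1 | h1
    · have : e ω = 0 := by
        simp only [he, hw, hω, hcH]
        rw [← h1, mul_sum, ← sum_sub_distrib]
        exact sum_eq_zero fun k _ => by ring
      rw [this, zero_mul]
    · rw [h1]; ring
  set j : Ω → Ω := fun ω => if H ω < c then ω else k₀ with hj
  have hjg : ∀ ω, 0 < g (j ω) := fun ω => by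
    simp only [hj]; split_ifs with h1
    exacts [(hHactive ω h1).1, hk₀]
  set θ : Ω → Ω → ℝ := fun ω k => p k * w ω k + if k = j ω then e ω else 0 with hθ
  refine ⟨θ, ?_, ?_, ?_, ?_⟩
  · intro ω k
    refine add_nonneg (mul_nonneg (hp k).le (hw0 _ _)) ?_
    split_ifs
    exacts [he0 ω, le_rfl]
  · intro ω
    simp only [hθ, sum_add_distrib, sum_ite_eq', mem_univ, if_true, he]
    ring
  · intro ω k hgk
    have h1 : w ω k = 0 := by
      by_contra hne
      exact (hwactive ω k hne).1.ne' hgk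
    have h2 : k ≠ j ω := by
      rintro rfl
      exact (hjg ω).ne' hgk
    simp only [hθ, h1, if_neg h2]; ring
  have hval : ∀ ω, (∑ v, if v = ω then 0 else p v * psi (θ ω v / p v)) / 1.12
        - ∑ k, θ ω k * Real.log (g k) ≤ H ω - 28 / 25 * ∑ k, p k * max (H ω - H k) 0 ^ 2 := by
    intro ω
    have hlog : ∑ k, θ ω k * Real.log (g k) = e ω * Real.log (g (j ω)) - ∑ k, p k * w ω k * H k := by
      have : ∀ k, p k * w ω k * Real.log (g k) = - (p k * w ω k * H k) := fun k => by
        by_cases hne : w ω k = 0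
        · rw [hne]; ring
        · rw [← (hwactive ω k hne).2]; ring
      simp only [hθ, add_mul, sum_add_distrib, this, sum_neg_distrib, ite_mul, zero_mul,
        sum_ite_eq', mem_univ, if_true]
      ring
    have hcost : ∑ v, (if v = ω then 0 else p v * psi (θ ω v / p v)) ≤
        ∑ v, p v * (w ω v ^ 2 / 4) + if j ω = ω then 0 else e ω := by
      have hv : ∀ v, (if v = ω then 0 else p v * psi (θ ω v / p v)) ≤
          p v * (w ω v ^ 2 / 4) + if v = j ω then (if v = ω then 0 else e ω) else 0 := by
        intro v
        have hpsi : psi (w ω v) = w ω v ^ 2 / 4 := if_pos (hw2 ω v)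
        have hpv := hp v
        split_ifs with h1 h2 h2
        · have := mul_nonneg hpv.le (sq_nonneg (w ω v)); linarith
        · have := mul_nonneg hpv.le (sq_nonneg (w ω v)); linarith
        · have h3 : θ ω v / p v = w ω v + e ω / p v := by
            simp only [hθ, if_pos h2]; field_simp
          have h4 := psi_add_le (x := w ω v) (div_nonneg (he0 ω) hpv.le)
          rw [h3]
          calc _ ≤ p v * (psi (w ω v) + e ω / p v) := mul_le_mul_of_nonneg_left h4 hpv.le
            _ = _ := by rw [hpsi]; field_simp
        · have h3 : θ ω v / p v = w ω v := by
            simp only [hθ, if_neg h2]; field_simp; ring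
          rw [h3, hpsi, add_zero]
      refine (sum_le_sum fun v _ => hv v).trans_eq ?_
      simp only [sum_add_distrib, sum_ite_eq', mem_univ, if_true]
    have hsq : ∑ v, p v * (w ω v ^ 2 / 4) =
        (28 / 25) ^ 2 * ∑ k, p k * max (H ω - H k) 0 ^ 2 := by
      rw [mul_sum]
      exact sum_congr rfl fun k _ => by simp only [hw]; ring
    have hlin : ∑ k, p k * w ω k * H k =
        H ω * (1 - e ω) - 56 / 25 * ∑ k, p k * max (H ω - H k) 0 ^ 2 := by
      have h1 : 1 - e ω = ∑ k, p k * w ω k := by simp only [he]; ring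
      rw [h1, mul_sum, mul_sum, ← sum_sub_distrib]
      refine sum_congr rfl fun k _ => ?_
      simp only [hw]
      rcases le_total (H ω) (H k) with h2 | h2
      · rw [max_eq_right (by linarith)]; ring
      · rw [max_eq_left (by linarith)]; ring
    have hrem : (if j ω = ω then 0 else e ω) / 1.12 - e ω * Real.log (g (j ω)) ≤ e ω * H ω := by
      rcases lt_or_ge (H ω) c with h1 | h1
      · have h2 : j ω = ω := if_pos h1
        have := (hHactive ω h1).2
        rw [if_pos h2, h2, ← this]; apply le_of_eq; ring
      · have h2 : j ω = k₀ := if_neg (not_lt.2 h1)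
        have h3 : H ω = c := le_antisymm (hHc ω) h1
        have h4 := hec ω h3
        have h5 : (if j ω = ω then 0 else e ω) ≤ e ω := by
          split_ifs
          exacts [he0 ω, le_rfl]
        have h6 : Real.log (g (j ω)) = -h₀ := by rw [h2, hh₀]; ring
        rw [h6, h3]
        norm_num
        linarith
    rw [hlog, hlin]
    rw [hsq] at hcost
    norm_num at hcost hrem ⊢
    linarith
  calc _ ≤ (∑ ω, p ω * Real.exp (H ω - 28 / 25 * ∑ k, p k * max (H ω - H k) 0 ^ 2)) *
        ∑ k, p k * Real.exp (-H k) := by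
        refine mul_le_mul (sum_le_sum fun ω _ => ?_) (sum_le_sum fun k _ => ?_)
          (sum_nonneg fun k _ => mul_nonneg (hp k).le (hg k))
          (sum_nonneg fun k _ => mul_nonneg (hp k).le (Real.exp_pos _).le)
        · exact mul_le_mul_of_nonneg_left (Real.exp_le_exp.2 (hval ω)) (hp ω).le
        · exact mul_le_mul_of_nonneg_left
            ((hexp k).trans (Real.exp_le_exp.2 (neg_le_neg (hHh k)))) (hp k).le
    _ ≤ 1 := sum_exp_mul_sum_exp_neg_le_one p H (fun i => (hp i).le) hsum h₀ hHlb
        (fun i => (hHc i).trans hc1)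

/-! ### Induction on the number of coordinates -/

theorem sum_fin_succ_fun {Ω : Type*} [Fintype Ω] {n : ℕ} (F : (Fin (n + 1) → Ω) → ℝ) :
    ∑ y, F y = ∑ k, ∑ y : Fin n → Ω, F (Fin.cons k y) := by
  rw [← (Fin.consEquiv fun _ => Ω).sum_comp, Fintype.sum_prod_type]
  rfl

section Induction

variable {Ω : Type*} [Fintype Ω] [DecidableEq Ω] {n : ℕ}

/-- The mass that `q` gives to `{y | y i = v, y i ≠ x i}`: the mass at `v` of `offMarginal`, when `q`
is the vector of point masses of a measure. -/
def offMass (q : (Fin n → Ω) → ℝ) (x : Fin n → Ω) (i : Fin n) (v : Ω) : ℝ :=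
  ∑ y, if y i = v ∧ y i ≠ x i then q y else 0

/-- The functional `m(ν, x)`, for a measure `ν` with point masses `q` and a base measure with point
masses `p`. -/
noncomputable def cost (p : Ω → ℝ) (q : (Fin n → Ω) → ℝ) (x : Fin n → Ω) : ℝ :=
  ∑ i, ∑ v, p v * psi (offMass q x i v / p v)

theorem cost_nonneg {p : Ω → ℝ} (hp : ∀ ω, 0 < p ω) (q : (Fin n → Ω) → ℝ) (x : Fin n → Ω) :
    0 ≤ cost p q x :=
  Finset.sum_nonneg fun _ _ => Finset.sum_nonneg fun v _ => mul_nonneg (hp v).le (psi_nonneg _)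

/-- The point masses of `∑ k, θ k • (δ_k ⊗ Q k)`. -/
def mixture (θ : Ω → ℝ) (Q : Ω → (Fin n → Ω) → ℝ) (y : Fin (n + 1) → Ω) : ℝ :=
  θ (y 0) * Q (y 0) (Fin.tail y)

theorem offMass_mixture_zero (θ : Ω → ℝ) (Q : Ω → (Fin n → Ω) → ℝ)
    (hQ : ∀ k, θ k ≠ 0 → ∑ y, Q k y = 1) (ω v : Ω) (x : Fin n → Ω) :
    offMass (mixture θ Q) (Fin.cons ω x : Fin (n + 1) → Ω) 0 v = if v = ω then 0 else θ v := by
  have h1 : ∀ k, ∑ y, θ k * Q k y = θ k := fun k => by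
    rw [← Finset.mul_sum]
    by_cases h : θ k = 0
    · rw [h, zero_mul]
    · rw [hQ k h, mul_one]
  simp only [offMass, sum_fin_succ_fun, mixture, Fin.cons_zero, Fin.tail_cons]
  rw [Finset.sum_eq_single v]
  · by_cases h : v = ω
    · simp [h]
    · simp [h, h1]
  · intro k _ hk
    simp [hk]
  · simp

theorem offMass_mixture_succ (θ : Ω → ℝ) (Q : Ω → (Fin n → Ω) → ℝ) (ω v : Ω) (x : Fin n → Ω)
    (i : Fin n) : offMass (mixture θ Q) (Fin.cons ω x : Fin (n + 1) → Ω) i.succ v =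
      ∑ k, θ k * offMass (Q k) x i v := by
  simp only [offMass, sum_fin_succ_fun, mixture, Fin.cons_succ, Fin.cons_zero, Fin.tail_cons,
    Finset.mul_sum, mul_ite, mul_zero]

open Finset in
/-- The cost of a mixture splits into the cost of `θ` in the first coordinate and, by convexity of
`psi`, at most the average of the costs of the components. Components of weight zero need not be
normalised, as they belong to empty sections. -/
theorem cost_mixture_le {p : Ω → ℝ} (hp : ∀ ω, 0 < p ω) (θ : Ω → ℝ) (hθ : ∀ k, 0 ≤ θ k)
    (hsum : ∑ k, θ k = 1) (Q : Ω → (Fin n → Ω) → ℝ) (hQ : ∀ k, θ k ≠ 0 → ∑ y, Q k y = 1) (ω : Ω)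
    (x : Fin n → Ω) :
    cost p (mixture θ Q) (Fin.cons ω x : Fin (n + 1) → Ω) ≤
      (∑ v, if v = ω then 0 else p v * psi (θ v / p v)) + ∑ k, θ k * cost p (Q k) x := by
  rw [cost, Fin.sum_univ_succ]
  simp only [offMass_mixture_zero θ Q hQ, offMass_mixture_succ]
  refine add_le_add (sum_le_sum fun v _ => ?_) ?_
  · split_ifs
    · rw [zero_div, psi_zero, mul_zero]
    · exact le_rfl
  · have h1 : ∀ i : Fin n, ∀ v, p v * psi ((∑ k, θ k * offMass (Q k) x i v) / p v) ≤
        ∑ k, θ k * (p v * psi (offMass (Q k) x i v / p v)) := fun i v => by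
      have h2 : (∑ k, θ k * offMass (Q k) x i v) / p v =
          ∑ k, θ k * (offMass (Q k) x i v / p v) := by
        rw [sum_div]; exact sum_congr rfl fun k _ => mul_div_assoc _ _ _
      rw [h2]
      refine (mul_le_mul_of_nonneg_left
        (psi_sum_le univ θ _ (fun k _ => hθ k) hsum) (hp v).le).trans_eq ?_
      rw [mul_sum]
      exact sum_congr rfl fun k _ => by ring
    calc _ ≤ ∑ i : Fin n, ∑ v, ∑ k, θ k * (p v * psi (offMass (Q k) x i v / p v)) :=
          sum_le_sum fun i _ => sum_le_sum fun v _ => h1 i v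
      _ = ∑ k, θ k * cost p (Q k) x := by
          simp only [cost, mul_sum]
          rw [sum_comm (s := univ (α := Ω)) (t := univ (α := Fin n))]
          exact sum_congr rfl fun i _ => sum_comm

open Finset in
/-- Hölder's inequality for several factors with exponents `1 / θ k`, normalised so that each factor has
integral at most one. -/
theorem sum_exp_mixture_le_one {ι κ : Type*} [Fintype ι] [Fintype κ] (P : ι → ℝ)
    (hP : ∀ i, 0 ≤ P i) (θ : κ → ℝ) (hθ : ∀ k, 0 ≤ θ k) (hsum : ∑ k, θ k = 1) (a : κ → ι → ℝ)
    (ha : ∀ k, θ k ≠ 0 → ∑ i, P i * Real.exp (a k i) ≤ 1) :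
    ∑ i, P i * Real.exp (∑ k, θ k * a k i) ≤ 1 := by
  calc _ ≤ ∑ i, P i * ∑ k, θ k * Real.exp (a k i) :=
        sum_le_sum fun i _ => mul_le_mul_of_nonneg_left
          (convexOn_exp.map_sum_le (fun k _ => hθ k) hsum fun _ _ => Set.mem_univ _) (hP i)
    _ = ∑ k, θ k * ∑ i, P i * Real.exp (a k i) := by
        simp only [mul_sum]
        rw [sum_comm]
        exact sum_congr rfl fun k _ => sum_congr rfl fun i _ => by ring
    _ ≤ ∑ k, θ k * 1 := sum_le_sum fun k _ => by
        by_cases h : θ k = 0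
        · simp [h]
        · exact mul_le_mul_of_nonneg_left (ha k h) (hθ k)
    _ = 1 := by simp [hsum]

open Finset in
/-- The theorem for finite sums, with an explicit choice of the weights `q x` carried by `A`. -/
theorem exists_kernel (p : Ω → ℝ) (hp : ∀ ω, 0 < p ω) (hsum : ∑ ω, p ω = 1) (n : ℕ)
    (A : Finset (Fin n → Ω)) (hA : A.Nonempty) :
    ∃ q : (Fin n → Ω) → (Fin n → Ω) → ℝ, (∀ x y, 0 ≤ q x y) ∧ (∀ x, ∑ y, q x y = 1) ∧
      (∀ x y, y ∉ A → q x y = 0) ∧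
      (∑ x, (∏ i, p (x i)) * Real.exp (cost p (q x) x / 1.12)) * ∑ y ∈ A, ∏ i, p (y i) ≤ 1 := by
  induction n with
  | zero =>
    obtain ⟨y, hy⟩ := hA
    refine ⟨fun _ _ => 1, fun _ _ => zero_le_one, fun _ => by simp, fun x z hz => ?_, ?_⟩
    · exact absurd (Subsingleton.elim y z ▸ hy) hz
    · have : A = univ := by
        exact eq_univ_of_forall fun z => Subsingleton.elim y z ▸ hy
      simp [this, cost]
  | succ n ih =>
    set S : Ω → Finset (Fin n → Ω) :=
      fun k => univ.filter fun y => (Fin.cons k y : Fin (n + 1) → Ω) ∈ A with hS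
    set g : Ω → ℝ := fun k => ∑ y ∈ S k, ∏ i, p (y i) with hg
    have hP : ∀ {m : ℕ} (y : Fin m → Ω), 0 < ∏ i, p (y i) := fun y => prod_pos fun i _ => hp _
    have hg0 : ∀ k, 0 ≤ g k := fun k => sum_nonneg fun y _ => (hP y).le
    have hgpos : ∀ k, g k ≠ 0 → (S k).Nonempty := fun k hk => by
      by_contra hcon
      rw [not_nonempty_iff_eq_empty] at hcon
      exact hk (by simp [hg, hcon])
    have hPA : ∑ y ∈ A, ∏ i, p (y i) = ∑ k, p k * g k := by
      have h1 : ∑ y ∈ A, ∏ i, p (y i) = ∑ y, if y ∈ A then ∏ i, p (y i) else 0 := by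
        rw [sum_ite_mem, univ_inter]
      rw [h1, sum_fin_succ_fun]
      refine sum_congr rfl fun k _ => ?_
      simp only [hg, hS, mul_sum, sum_filter, Fin.prod_univ_succ, Fin.cons_zero, Fin.cons_succ,
        mul_ite, mul_zero]
    have hk₁ : ∃ k, 0 < g k := by
      obtain ⟨y, hy⟩ := hA
      refine ⟨y 0, sum_pos (fun z _ => hP z) ⟨Fin.tail y, ?_⟩⟩
      simpa [hS] using hy
    -- for an empty section the choice is immaterial, since `θ` gives it no weight
    have hsel : ∀ k, ∃ q : (Fin n → Ω) → (Fin n → Ω) → ℝ, (∀ x y, 0 ≤ q x y) ∧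
        (∀ x y, y ∉ S k → q x y = 0) ∧ (g k ≠ 0 → (∀ x, ∑ y, q x y = 1) ∧
          (∑ x, (∏ i, p (x i)) * Real.exp (cost p (q x) x / 1.12)) * g k ≤ 1) := fun k => by
      by_cases hk : g k = 0
      · exact ⟨fun _ _ => 0, fun _ _ => le_rfl, fun _ _ _ => rfl, fun h => absurd hk h⟩
      · obtain ⟨q, h1, h2, h3, h4⟩ := ih (S k) (hgpos k hk)
        exact ⟨q, h1, h3, fun _ => ⟨h2, h4⟩⟩
    choose Q hQ0 hQS hQ using hsel
    obtain ⟨k₁, hk₁⟩ := hk₁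
    obtain ⟨k₀, -, hk₀⟩ := exists_max_image univ g ⟨k₁, mem_univ _⟩
    obtain ⟨θ, hθ0, hθ1, hθg, hθ⟩ := exists_weights p hp hsum g hg0 k₀
      (hk₁.trans_le (hk₀ k₁ (mem_univ _))) fun k => hk₀ k (mem_univ _)
    have hθQ : ∀ ω x k, θ ω k ≠ 0 → ∑ y, Q k x y = 1 := fun ω x k hk =>
      (hQ k fun h => hk (hθg ω k h)).1 x
    refine ⟨fun x => mixture (θ (x 0)) fun k => Q k (Fin.tail x), ?_, ?_, ?_, ?_⟩
    · exact fun x y => mul_nonneg (hθ0 _ _) (hQ0 _ _ _)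
    · intro x
      rw [sum_fin_succ_fun, ← hθ1 (x 0)]
      refine sum_congr rfl fun k _ => ?_
      simp only [mixture, Fin.cons_zero, Fin.tail_cons, ← mul_sum]
      by_cases h : θ (x 0) k = 0
      · rw [h, zero_mul]
      · rw [hθQ _ _ k h, mul_one]
    · intro x y hy
      have : Fin.tail y ∉ S (y 0) := by simpa [hS] using hy
      simp only [mixture, hQS _ _ _ this, mul_zero]
    · rw [hPA, sum_fin_succ_fun]
      refine le_trans (mul_le_mul_of_nonneg_right (sum_le_sum fun ω _ => ?_)
        (sum_nonneg fun k _ => mul_nonneg (hp k).le (hg0 k))) hθ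
      simp only [Fin.cons_zero, Fin.tail_cons, Fin.prod_univ_succ, Fin.cons_succ]
      set c := ∑ v, if v = ω then 0 else p v * psi (θ ω v / p v) with hc
      have hslice := sum_exp_mixture_le_one (fun x : Fin n → Ω => ∏ i, p (x i))
        (fun x => (hP x).le) (θ ω) (hθ0 ω) (hθ1 ω)
        (fun k x => cost p (Q k x) x / 1.12 + Real.log (g k)) (fun k hk => by
          have hgk : g k ≠ 0 := fun h => hk (hθg ω k h)
          have hgk' : 0 < g k := lt_of_le_of_ne (hg0 k) hgk.symm
          refine le_of_eq_of_le ?_ (hQ k hgk).2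
          rw [sum_mul]
          exact sum_congr rfl fun x _ => by rw [Real.exp_add, Real.exp_log hgk', mul_assoc])
      calc _ ≤ ∑ x : Fin n → Ω, p ω * Real.exp (c / 1.12 - ∑ k, θ ω k * Real.log (g k)) *
            ((∏ i, p (x i)) *
              Real.exp (∑ k, θ ω k * (cost p (Q k x) x / 1.12 + Real.log (g k)))) := by
            refine sum_le_sum fun x _ => ?_
            have h1 := cost_mixture_le hp (θ ω) (hθ0 ω) (hθ1 ω) (fun k => Q k x)
              (hθQ ω x) ω x
            have h2 : ∑ k, θ ω k * (cost p (Q k x) x / 1.12 + Real.log (g k)) =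
                (∑ k, θ ω k * cost p (Q k x) x) / 1.12 + ∑ k, θ ω k * Real.log (g k) := by
              rw [sum_div, ← sum_add_distrib]
              exact sum_congr rfl fun k _ => by ring
            have h3 : cost p (mixture (θ ω) fun k => Q k x) (Fin.cons ω x : Fin (n + 1) → Ω) / 1.12
                ≤ (c / 1.12 - ∑ k, θ ω k * Real.log (g k)) +
                  ∑ k, θ ω k * (cost p (Q k x) x / 1.12 + Real.log (g k)) := by
              rw [h2]
              norm_num at h1 ⊢
              linarith
            calc _ ≤ p ω * (∏ i, p (x i)) * Real.exp (_ + _) :=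
                  mul_le_mul_of_nonneg_left (Real.exp_le_exp.2 h3)
                    (mul_nonneg (hp ω).le (hP x).le)
              _ = _ := by rw [Real.exp_add]; ring
        _ ≤ _ := by
            rw [← mul_sum]
            exact mul_le_of_le_one_right (mul_nonneg (hp ω).le (Real.exp_pos _).le) hslice

end Induction

/-! ### Passage from point masses to measures -/

section Discrete

variable {α : Type*} [Fintype α] [MeasurableSpace α] [MeasurableSingletonClass α]

/-- The measure on a finite type with point masses `q` (negative values of `q` count as zero). -/
noncomputable def discreteMeasure (q : α → ℝ) : Measure α :=
  ∑ y, ENNReal.ofReal (q y) • Measure.dirac y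

open Classical in
theorem discreteMeasure_apply {q : α → ℝ} (hq : ∀ y, 0 ≤ q y) (s : Set α) :
    discreteMeasure q s = ENNReal.ofReal (∑ y, if y ∈ s then q y else 0) := by
  rw [discreteMeasure, Measure.finsetSum_apply,
    ENNReal.ofReal_sum_of_nonneg fun y _ => by split_ifs; exacts [hq y, le_rfl]]
  refine Finset.sum_congr rfl fun y _ => ?_
  by_cases h : y ∈ s <;> simp [h]

theorem toReal_rnDeriv_eq_div {μ ρ : Measure α} [IsFiniteMeasure μ] [IsFiniteMeasure ρ]
    (hμ : ∀ ω, 0 < μ {ω}) (v : α) :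
    (ρ.rnDeriv μ v).toReal = (ρ {v}).toReal / (μ {v}).toReal := by
  have hac : ρ ≪ μ := fun s hs => by
    have : s = ∅ := by
      by_contra hne
      obtain ⟨ω, hω⟩ := Set.nonempty_iff_ne_empty.2 hne
      exact (hμ ω).ne' (measure_mono_null (Set.singleton_subset_iff.2 hω) hs)
    simp [this]
  have h : ρ {v} = ρ.rnDeriv μ v * μ {v} := by
    conv_lhs => rw [← Measure.withDensity_rnDeriv_eq ρ μ hac]
    rw [withDensity_apply _ (measurableSet_singleton v), lintegral_singleton]
  have hne : (μ {v}).toReal ≠ 0 := ENNReal.toReal_ne_zero.2 ⟨(hμ v).ne', measure_ne_top _ _⟩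
  rw [h, ENNReal.toReal_mul, mul_div_cancel_right₀ _ hne]

end Discrete

section Measures

variable {Ω : Type*} [Fintype Ω] [DecidableEq Ω] [MeasurableSpace Ω] [MeasurableSingletonClass Ω]
  {n : ℕ}

theorem mMeas_discreteMeasure (μ : Measure Ω) [IsFiniteMeasure μ] (hμ : ∀ ω, 0 < μ {ω})
    {q : (Fin n → Ω) → ℝ} (hq : ∀ y, 0 ≤ q y) (x : Fin n → Ω) :
    mMeas μ (discreteMeasure q) x = cost (fun ω => (μ {ω}).toReal) q x := by
  have hfin : IsFiniteMeasure (discreteMeasure q) :=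
    ⟨by rw [discreteMeasure_apply hq]; exact ENNReal.ofReal_lt_top⟩
  unfold mMeas cost
  refine Finset.sum_congr rfl fun i _ => ?_
  rw [integral_fintype (by exact .of_finite)]
  refine Finset.sum_congr rfl fun v _ => ?_
  have hmeas : Measurable fun y : Fin n → Ω => y i := measurable_pi_apply i
  have hfin' : IsFiniteMeasure (offMarginal (discreteMeasure q) x i) := by
    unfold offMarginal; infer_instance
  have hoff : (offMarginal (discreteMeasure q) x i {v}).toReal = offMass q x i v := by
    have hset : MeasurableSet ((fun y : Fin n → Ω => y i) ⁻¹' {v}) :=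
      hmeas (measurableSet_singleton v)
    rw [offMarginal, Measure.map_apply hmeas (measurableSet_singleton v),
      Measure.restrict_apply hset, discreteMeasure_apply hq,
      ENNReal.toReal_ofReal (Finset.sum_nonneg fun y _ => by split_ifs; exacts [hq y, le_rfl])]
    unfold offMass
    refine Finset.sum_congr rfl fun y _ => ?_
    congr 1
  rw [density, toReal_rnDeriv_eq_div hμ, hoff]
  rfl

theorem exp_mSet_div_le (μ : Measure Ω) [IsFiniteMeasure μ] (hμ : ∀ ω, 0 < μ {ω}) {L : ℝ}
    (hL : 1.12 ≤ L) {A : Set (Fin n → Ω)} {q : (Fin n → Ω) → ℝ} (hq : ∀ y, 0 ≤ q y)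
    (hsum : ∑ y, q y = 1) (hA : ∀ y, y ∉ A → q y = 0) (x : Fin n → Ω) :
    EReal.exp (mSet μ A x / (L : EReal)) ≤
      ENNReal.ofReal (Real.exp (cost (fun ω => (μ {ω}).toReal) q x / 1.12)) := by
  have hL0 : (0 : ℝ) < 1.12 := by norm_num
  have hν : discreteMeasure q A = 1 := by
    rw [discreteMeasure_apply hq, ← ENNReal.ofReal_one, ← hsum]
    congr 1
    refine Finset.sum_congr rfl fun y _ => ?_
    split_ifs with h
    exacts [rfl, (hA y h).symm]
  have hprob : IsProbabilityMeasure (discreteMeasure q) := ⟨by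
    rw [discreteMeasure_apply hq]; simp [hsum]⟩
  have h1 : mSet μ A x ≤ ((cost (fun ω => (μ {ω}).toReal) q x : ℝ) : EReal) := by
    rw [← mMeas_discreteMeasure μ hμ hq x]
    exact iInf₂_le (⟨discreteMeasure q, hprob⟩ : ProbabilityMeasure (Fin n → Ω)) hν
  have hp : ∀ ω, 0 < (μ {ω}).toReal := fun ω => ENNReal.toReal_pos (hμ ω).ne' (measure_ne_top _ _)
  rw [← EReal.exp_coe]
  apply EReal.exp_monotone
  calc mSet μ A x / (L : EReal)
      ≤ ((cost (fun ω => (μ {ω}).toReal) q x : ℝ) : EReal) / (L : EReal) :=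
        EReal.div_le_div_right_of_nonneg (by exact_mod_cast hL0.le.trans hL) h1
    _ = ((cost (fun ω => (μ {ω}).toReal) q x / L : ℝ) : EReal) := (EReal.coe_div _ _).symm
    _ ≤ _ := EReal.coe_le_coe_iff.2
        (div_le_div_of_nonneg_left (cost_nonneg hp q x) hL0 hL)

end Measures

end TalagrandDist

theorem theorem1 {Ω : Type*} [Finite Ω] [MeasurableSpace Ω] [MeasurableSingletonClass Ω]
    (μ : Measure Ω) [IsProbabilityMeasure μ] (hμ : ∀ ω : Ω, 0 < μ {ω})
    (L : ℝ) (hL : 1.12 ≤ L) (n : ℕ) (A : Set (Fin n → Ω)) :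
    ∫⁻ x, EReal.exp (TalagrandDist.mSet μ A x / (L : EReal)) ∂(Measure.pi fun _ : Fin n => μ)
      ≤ 1 / (Measure.pi fun _ : Fin n => μ) A := by
  classical
  have := Fintype.ofFinite Ω
  rcases A.eq_empty_or_nonempty with rfl | hne
  · simp
  set p : Ω → ℝ := fun ω => (μ {ω}).toReal with hp
  have hp0 : ∀ ω, 0 < p ω := fun ω => ENNReal.toReal_pos (hμ ω).ne' (measure_ne_top _ _)
  have hsum : ∑ ω, p ω = 1 := by
    have h := sum_measureReal_singleton (μ := μ) Finset.univ
    simpa [Measure.real] using h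
  have hpi : ∀ x : Fin n → Ω, (Measure.pi fun _ : Fin n => μ) {x} = ENNReal.ofReal (∏ i, p (x i)) :=
    fun x => by
      rw [Measure.pi_singleton, ENNReal.ofReal_prod_of_nonneg fun i _ => (hp0 _).le]
      exact Finset.prod_congr rfl fun i _ => (ENNReal.ofReal_toReal (measure_ne_top _ _)).symm
  have hprod : ∀ x : Fin n → Ω, 0 < ∏ i, p (x i) := fun x => Finset.prod_pos fun i _ => hp0 _
  obtain ⟨q, hq0, hq1, hqA, hq⟩ := TalagrandDist.exists_kernel p hp0 hsum n A.toFinset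
    (Set.toFinset_nonempty.2 hne)
  have hPA : (Measure.pi fun _ : Fin n => μ) A =
      ENNReal.ofReal (∑ y ∈ A.toFinset, ∏ i, p (y i)) := by
    rw [ENNReal.ofReal_sum_of_nonneg fun y _ => (hprod y).le, ← Finset.sum_congr rfl fun y _ => hpi y,
      sum_measure_singleton, Set.coe_toFinset]
  have hPA0 : 0 < ∑ y ∈ A.toFinset, ∏ i, p (y i) :=
    Finset.sum_pos (fun y _ => hprod y) (Set.toFinset_nonempty.2 hne)
  calc _ ≤ ENNReal.ofReal
        (∑ x, (∏ i, p (x i)) * Real.exp (TalagrandDist.cost p (q x) x / 1.12)) := by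
        rw [lintegral_fintype, ENNReal.ofReal_sum_of_nonneg fun x _ =>
          mul_nonneg (hprod x).le (Real.exp_pos _).le]
        refine Finset.sum_le_sum fun x _ => ?_
        rw [hpi, mul_comm, ENNReal.ofReal_mul (hprod x).le]
        gcongr
        exact TalagrandDist.exp_mSet_div_le μ hμ hL (hq0 x) (hq1 x)
          (fun y hy => hqA x y (by simpa using hy)) x
    _ ≤ 1 / (Measure.pi fun _ : Fin n => μ) A := by
        rw [hPA, ← ENNReal.ofReal_one, ← ENNReal.ofReal_div_of_pos hPA0]
        exact ENNReal.ofReal_le_ofReal ((le_div_iff₀ hPA0).2 hq)
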